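/- Consider oriented virtual link diagrams: generic immersions of finitely many oriented circles in the plane, up to plane isotopy, in which every double point is either a virtual crossing or a classical crossing (with over/under information). A flat diagram is such a diagram without over/under information at the classical crossings. Free links are flat links considered up to virtualization (exchanging a classical and a virtual crossing that together form a bigon). The moves are: - the first Reidemeister move: adding or removing a kink with one classical crossing; - the second Reidemeister move: adding or removing a bigon face with two classical crossings (in the virtual case, one strand passes over the other at both crossings). It is called braid-like if the two strands are directed alike along the bigon, and unoriented if they are directed oppositely; - the third Reidemeister move: moving a strand across the opposite crossing of a triangular face with three classical crossings (in the virtual case, one of the three strands is above the other two). It is called braid-like if the boundary of the triangle is not a directed cycle, and unoriented if it is a directed cycle; - the detour move: replacing an arc that contains only virtual crossings (possibly none) by any other arc with the same ends that contains only virtual crossings. Theorem. The unoriented second and third Reidemeister moves cannot be expressed in terms of the braid-like second and third Reidemeister moves, the first Reidemeister move and the detour move. Precisely, for each of the three theories (virtual links, flat links, free links), where virtualization is also allowed in the case of free links: 1. there are diagrams $D,D'$ that differ by a single unoriented second Reidemeister move, but are not related by any finite sequence of first Reidemeister moves, braid-like second and third Reidemeister moves, detour moves and their inverses; 2. there are diagrams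 $D,D'$ that differ by a single unoriented third Reidemeister move, but are not related by any such sequence. -/

import Mathlib

namespace VirtualLinks

/-- The three kinds of knot theory: virtual links, flat virtual links and free links. -/
inductive LinkTheory where
  | virtual
  | flat
  | free

/-- A passage of a strand through the crossing named `c`.  Of the two strands that meet at a
crossing, `(c, true)` is the strand with direction `u` and `(c, false)` the one with direction `v`,
where the pair of directions `(u, v)` is a positive frame of the plane. -/
abbrev Passage : Type := ℕ × Bool

/-- The other passage through the same crossing. -/
def opp (p : Passage) : Passage := (p.1, !p.2)

/-- The data carried by a classical crossing.  For virtual links it names the overpassing strand;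
classical crossings of flat and of free links carry no data. -/
abbrev LinkTheory.Info : LinkTheory → Type
  | .virtual => Bool
  | .flat => Unit
  | .free => Unit

/-- `T.Above i e`: at a classical crossing with data `i` the strand `e` may be regarded as the upper
one.  For flat and free links this is no restriction. -/
def LinkTheory.Above : (T : LinkTheory) → T.Info → Bool → Prop
  | .virtual, i, e => i = e
  | .flat, _, _ => True
  | .free, _, _ => True

/-! ### Planar Gauss codes

An oriented diagram is recorded by the cyclic words of passages met along its components, where both
classical and virtual crossings are recorded. An empty word is a circle without crossings. -/

/-- All passages of a code. -/
def passages (W : List (List Passage)) : List Passage := W.flatten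

/-- The passage that follows a given one along its (cyclic) component. -/
def succ (W : List (List Passage)) : Equiv.Perm Passage := (W.map List.formPerm).prod

/-- The edges of the diagram are the segments from `p` to `succ W p`.  A pair `(p, true)` stands for
the left hand side of this edge, traversed forwards, and `(p, false)` for its right hand side,
traversed backwards.  The boundary of a face, kept on the left, is followed from each edge to the
next one by turning left at the crossing. -/
def faceStep (W : List (List Passage)) : Passage × Bool → Passage × Bool
  | (p, true) =>
      if (succ W p).2 then (opp (succ W p), true)
      else ((succ W).symm (opp (succ W p)), false)
  | (p, false) =>
      if p.2 then ((succ W).symm (opp p), false)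
      else (opp p, true)

/-- The faces of the ribbon graph of a code (circles without crossings are left out). -/
def Face (W : List (List Passage)) : Type :=
  Quot fun s t : {s : Passage × Bool // s.1 ∈ passages W} => faceStep W s.1 = t.1

/-- The connected pieces of the four-valent graph of a code. -/
def Piece (W : List (List Passage)) : Type :=
  Quot fun p q : {p : Passage // p ∈ passages W} => succ W p.1 = q.1 ∨ opp p.1 = q.1

/-- The code is the code of curves in the plane.  With `n` crossings, `2 * n` passages and
`2 * n` edges this is Euler's formula `n - 2 * n + #faces = 2 * #pieces`; since each piece has Euler
characteristic at most `2`, it says that each piece has genus `0`. -/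
def IsPlanar (W : List (List Passage)) : Prop :=
  2 * Nat.card (Face W) = (passages W).length + 4 * Nat.card (Piece W)

/-- An oriented link diagram in the plane (with virtual crossings) of the theory `T`. -/
structure Diagram (T : LinkTheory) where
  /-- one cyclic word of passages for each component -/
  words : List (List Passage)
  /-- `none` for a virtual crossing; the values at names that do not occur have no meaning -/
  info : ℕ → Option T.Info
  nodup : (passages words).Nodup
  opp_mem : ∀ p ∈ passages words, opp p ∈ passages words
  planar : IsPlanar words

variable {T : LinkTheory}

namespace Diagram

/-- `c` is the name of a crossing of `D`. -/
def HasCrossing (D : Diagram T) (c : ℕ) : Prop := (c, true) ∈ passages D.words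

/-- The passage `q` follows immediately after `p` (no classical or virtual crossing between). -/
def Next (D : Diagram T) (p q : Passage) : Prop :=
  p ∈ passages D.words ∧ succ D.words p = q

/-- A bigon face with vertices `x`, `y` whose two sides are directed alike, both from `x` to `y`. -/
def CoherentBigon (D : Diagram T) (x y : ℕ) (r : Bool) : Prop :=
  x ≠ y ∧ D.Next (x, r) (y, !r) ∧ D.Next (x, !r) (y, r)

/-- A bigon face with vertices `x`, `y` whose two sides are directed oppositely. -/
def IncoherentBigon (D : Diagram T) (x y : ℕ) (r : Bool) : Prop :=
  x ≠ y ∧ D.Next (x, r) (y, !r) ∧ D.Next (y, r) (x, !r)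

/-- One of the two strands that form a bigon with vertices `x`, `y` lies above the other one; in
particular both crossings are classical. -/
def BigonLayered (D : Diagram T) (x y : ℕ) (r : Bool) : Prop :=
  ∃ i j, D.info x = some i ∧ D.info y = some j ∧
    ((T.Above i r ∧ T.Above j (!r)) ∨ (T.Above i (!r) ∧ T.Above j r))

/-- `D` arises from `D'` by erasing the crossings with names in `s` (the strands stay). -/
def IsErasure (s : Finset ℕ) (D D' : Diagram T) : Prop :=
  D.words = D'.words.map (fun w => w.filter fun p => p.1 ∉ s) ∧
    ∀ c, D.HasCrossing c → D.info c = D'.info c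

/-- The same diagram, up to the names of the crossings, the order of the components and the starting
points on the components. -/
def Iso (D D' : Diagram T) : Prop :=
  ∃ f : Equiv.Perm ℕ,
    (D.words.map fun w => ((w.map (Prod.map f id) : List Passage) : Cycle Passage)).Perm
      (D'.words.map fun w => (w : Cycle Passage)) ∧
    ∀ c, D.HasCrossing c → D.info c = D'.info (f c)

/-- First Reidemeister move: `D'` is `D` with a classical kink added. -/
def R1 (D D' : Diagram T) : Prop :=
  ∃ (c : ℕ) (r : Bool), D'.Next (c, r) (c, !r) ∧ (∃ i, D'.info c = some i) ∧
    IsErasure {c} D D'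

/-- Braid-like second Reidemeister move (two strands directed alike). -/
def BraidLikeR2 (D D' : Diagram T) : Prop :=
  ∃ (x y : ℕ) (r : Bool), D'.CoherentBigon x y r ∧ D'.BigonLayered x y r ∧
    IsErasure {x, y} D D'

/-- Unoriented second Reidemeister move (two strands directed oppositely). -/
def UnorientedR2 (D D' : Diagram T) : Prop :=
  ∃ (x y : ℕ) (r : Bool), D'.IncoherentBigon x y r ∧ D'.BigonLayered x y r ∧
    IsErasure {x, y} D D'

/-- `D'` arises from `D` by exchanging `p` with `p'`, `q` with `q'` and `s` with `s'`. -/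
def IsTripleSwap (p p' q q' s s' : Passage) (D D' : Diagram T) : Prop :=
  D'.words = D.words.map
      (List.map (Equiv.swap p p' * Equiv.swap q q' * Equiv.swap s s' : Equiv.Perm Passage)) ∧
    ∀ c, D.HasCrossing c → D'.info c = D.info c

/-- Braid-like third Reidemeister move: the boundary of the triangle is not a directed cycle.  The
first strand passes `a` and `b`, the second one `a` and `c`, the third one `b` and `c`.  The last
condition says that one of the strands is above the two others. -/
def BraidLikeR3 (D D' : Diagram T) : Prop :=
  ∃ (a b c : ℕ) (r : Bool), a ≠ b ∧ a ≠ c ∧ b ≠ c ∧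
    D.Next (a, r) (b, r) ∧ D.Next (a, !r) (c, r) ∧ D.Next (b, !r) (c, !r) ∧
    (∃ i j k, D.info a = some i ∧ D.info b = some j ∧ D.info c = some k ∧
      ((T.Above i r ∧ T.Above j r) ∨ (T.Above i (!r) ∧ T.Above k r) ∨
        (T.Above j (!r) ∧ T.Above k (!r)))) ∧
    IsTripleSwap (a, r) (b, r) (a, !r) (c, r) (b, !r) (c, !r) D D'

/-- Unoriented third Reidemeister move: the boundary of the triangle is a directed cycle
`a → b → c → a`. -/
def UnorientedR3 (D D' : Diagram T) : Prop :=
  ∃ (a b c : ℕ) (r : Bool), a ≠ b ∧ a ≠ c ∧ b ≠ c ∧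
    D.Next (a, r) (b, !r) ∧ D.Next (b, r) (c, !r) ∧ D.Next (c, r) (a, !r) ∧
    (∃ i j k, D.info a = some i ∧ D.info b = some j ∧ D.info c = some k ∧
      ((T.Above i r ∧ T.Above j (!r)) ∨ (T.Above j r ∧ T.Above k (!r)) ∨
        (T.Above k r ∧ T.Above i (!r)))) ∧
    IsTripleSwap (a, r) (b, !r) (b, r) (c, !r) (c, r) (a, !r) D D'

/-- The passages of `A` through crossings that are not on the arc `u`. -/
def offArc (u A : List Passage) : List Passage := A.filter fun p => p.1 ∉ u.map Prod.fst

/-- Detour move: an arc `u` that has virtual crossings only (possibly with itself, possibly none) is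
replaced by an arc `u'` with the same ends that has virtual crossings only; the rest of the diagram
does not change. -/
def Detour (D D' : Diagram T) : Prop :=
  ∃ (A u A' u' : List Passage) (L L' : List (List Passage)),
    D.words = (A ++ u) :: L ∧ D'.words = (A' ++ u') :: L' ∧
    (∀ p ∈ u, D.info p.1 = none) ∧ (∀ p ∈ u', D'.info p.1 = none) ∧
    offArc u A = offArc u' A' ∧ L.map (offArc u) = L'.map (offArc u') ∧
    ∀ c, D.HasCrossing c → c ∉ u.map Prod.fst → D.info c = D'.info c

/-- Virtualization: a classical and a virtual crossing that form a bigon are exchanged. -/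
def Virtualization (D D' : Diagram T) : Prop :=
  ∃ (z v : ℕ) (r : Bool), (D.CoherentBigon z v r ∨ D.CoherentBigon v z r ∨
      D.IncoherentBigon z v r) ∧
    (∃ i, D.info z = some i) ∧ D.info v = none ∧
    D'.words = D.words ∧
    ∀ c, D.HasCrossing c → D'.info c = D.info (Equiv.swap z v c)

/-- The moves that are allowed: the first Reidemeister move, the braid-like second and third
Reidemeister moves and the detour move.  Free links are by definition flat links up to
virtualization. -/
inductive BraidLikeMove : Diagram T → Diagram T → Prop
  | iso {D D' : Diagram T} : Iso D D' → BraidLikeMove D D'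
  | r1 {D D' : Diagram T} : R1 D D' → BraidLikeMove D D'
  | r2 {D D' : Diagram T} : BraidLikeR2 D D' → BraidLikeMove D D'
  | r3 {D D' : Diagram T} : BraidLikeR3 D D' → BraidLikeMove D D'
  | detour {D D' : Diagram T} : Detour D D' → BraidLikeMove D D'
  | virtualization {D D' : Diagram T} : T = LinkTheory.free → Virtualization D D' →
      BraidLikeMove D D'

/-- `D'` can be obtained from `D` by finitely many allowed moves and their inverses. -/
def BraidLikeEquivalent (D D' : Diagram T) : Prop :=
  Relation.EqvGen BraidLikeMove D D'

end Diagram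

end VirtualLinks

/-! The invariant sees only which crossings are classical, so a single argument serves virtual, flat
and free links. Label each component by `κ`. Smooth the classical crossings of equally labelled
strands according to orientation, and count how often each resulting circle meets a classical
crossing of differently labelled strands. The diagram is balanced if all these counts are even, for
every `κ`. Evenness is expressed by a two-colouring `f` of the edges that changes exactly at the
mixed crossings.

A classical crossing thus acts on the incoming colours `(x, y)` of strands labelled `(u, v)`:
straight along the strands it gives `(y, x)` if `u = v` and `(!x, !y)` otherwise. This map is an
involution, hence invariance under the braid-like second move; it satisfies a Yang–Baxter relation,
hence invariance under the braid-like third move (`Balanced.triangle`). A smoothed kink only splits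
off a circle without mixed crossings (`Balanced.kink`), virtual crossings have no effect
(`balancedCode_filter_iff`), and virtualization is covered by `Balanced.coherentBigon` and
`Balanced.incoherentBigon`.

The unoriented moves, in contrast, can reconnect the smoothed circles. In the examples one side is
balanced, while on the other side a smoothed circle has exactly one mixed classical crossing, which
no colouring `f` allows. -/

namespace VirtualLinks

/-! ### The invariant for abstract passages -/

section Balanced

variable {α : Type*}

/-- The colour of the strand leaving `p` when `f` gives the colours of the strands entering the
passages: colours pass straight through virtual crossings, follow the oriented smoothing at
classical crossings of two strands with the same label `κ`, and change at classical crossings of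
strands with different labels. -/
def outColour (θ : α → α) (cl κ f : α → Bool) (p : α) : Bool :=
  bif cl p then (bif κ p == κ (θ p) then f (θ p) else !f p) else f p

/-- For each labelling of the components, the circles obtained by smoothing the classical crossings
of equally labelled strands run an even number of times through the other classical crossings.
Here `S` is the set of passages, `σ` the successor and `θ p` the other passage at the crossing. -/
def Balanced (S : Set α) (σ θ : α → α) (cl : α → Bool) : Prop :=
  ∀ κ : α → Bool, (∀ p ∈ S, κ (σ p) = κ p) →
    ∃ f : α → Bool, ∀ p ∈ S, f (σ p) = outColour θ cl κ f p

theorem outColour_congr {θ θ' : α → α} {cl cl' κ f f' : α → Bool} {p : α} (hcl : cl' p = cl p)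
    (hθ : cl p → θ' p = θ p) (hf : f' p = f p) (hfθ : cl p → f' (θ p) = f (θ p)) :
    outColour θ' cl' κ f' p = outColour θ cl κ f p := by
  unfold outColour
  cases h : cl p
  · simp [hcl, h, hf]
  · simp [hcl, h, hf, hθ h, hfθ h]

theorem Balanced.transport {β : Type*} {S : Set α} {S' : Set β} {σ θ : α → α} {σ' θ' : β → β}
    {cl : α → Bool} {cl' : β → Bool} (h : Balanced S' σ' θ' cl') (E : α ≃ β)
    (hS : ∀ p ∈ S, E p ∈ S') (hE : ∀ q ∈ S', E.symm q ∈ S) (hσ : ∀ p ∈ S, σ' (E p) = E (σ p))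
    (hcl : ∀ p ∈ S, cl' (E p) = cl p) (hθ : ∀ p ∈ S, θ' (E p) = E (θ p)) :
    Balanced S σ θ cl := by
  intro κ hκ
  obtain ⟨f, hf⟩ := h (fun q => κ (E.symm q)) (by
    intro q hq
    have := hσ _ (hE q hq)
    rw [Equiv.apply_symm_apply] at this
    rw [this, Equiv.symm_apply_apply, hκ _ (hE q hq)])
  refine ⟨fun p => f (E p), fun p hp => ?_⟩
  have h1 := hf _ (hS p hp)
  rw [hσ p hp] at h1
  simp only [h1, outColour, hcl p hp, hθ p hp, Equiv.symm_apply_apply]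

theorem balanced_iff_of_equiv {β : Type*} {S : Set α} {S' : Set β} {σ θ : α → α} {σ' θ' : β → β}
    {cl : α → Bool} {cl' : β → Bool} (E : α ≃ β) (hS : ∀ p ∈ S, E p ∈ S')
    (hE : ∀ q ∈ S', E.symm q ∈ S) (hσ : ∀ p ∈ S, σ' (E p) = E (σ p))
    (hcl : ∀ p ∈ S, cl' (E p) = cl p) (hθ : ∀ p ∈ S, θ' (E p) = E (θ p)) :
    Balanced S σ θ cl ↔ Balanced S' σ' θ' cl' := by
  refine ⟨fun h => h.transport E.symm hE (by simpa using hS) (fun q hq => ?_) (fun q hq => ?_)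
    fun q hq => ?_, fun h => h.transport E hS hE hσ hcl hθ⟩
  · rw [Equiv.eq_symm_apply, ← hσ _ (hE q hq), Equiv.apply_symm_apply]
  · rw [← hcl _ (hE q hq), Equiv.apply_symm_apply]
  · rw [Equiv.eq_symm_apply, ← hθ _ (hE q hq), Equiv.apply_symm_apply]

/-- This confines a move to a disc: `K` consists of the passages at the crossings involved, and `Q`
of those entered along edges inside the disc. The labels survive because `σ` is fixed, so it
suffices to recolour the inner edges so that the colours leaving the disc stay as they were. -/
theorem Balanced.of_local {S : Set α} {σ θ θ' : α → α} {cl cl' : α → Bool}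
    (h : Balanced S σ θ cl) (Q K : Set α) (hQK : Q ⊆ K) (hQ : ∀ p ∈ S, σ p ∈ Q → p ∈ K)
    (hoff : ∀ p ∈ S, p ∉ K → cl' p = cl p ∧ (cl p → θ' p = θ p ∧ θ p ∉ K))
    (hloc : ∀ κ f : α → Bool, (∀ p ∈ S, κ (σ p) = κ p) →
      (∀ p ∈ S, f (σ p) = outColour θ cl κ f p) →
      ∃ f' : α → Bool, (∀ p, p ∉ Q → f' p = f p) ∧
        ∀ p ∈ K, f' (σ p) = outColour θ' cl' κ f' p) :
    Balanced S σ θ' cl' := by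
  intro κ hκ
  obtain ⟨f, hf⟩ := h κ hκ
  obtain ⟨f', h1, h2⟩ := hloc κ f hκ hf
  refine ⟨f', fun p hp => ?_⟩
  by_cases hpK : p ∈ K
  · exact h2 p hpK
  · obtain ⟨h3, h4⟩ := hoff p hp hpK
    rw [h1 (σ p) fun h => hpK (hQ p hp h), hf p hp]
    exact (outColour_congr h3 (fun h => (h4 h).1) (h1 _ fun h => hpK (hQK h))
      (fun h => h1 _ fun h' => (h4 h).2 (hQK h'))).symm

/-- A virtual passage can be erased. -/
theorem balanced_erase_iff [DecidableEq α] {S : Set α} {σ σ' θ : α → α} {cl : α → Bool}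
    {p : α} (hpS : p ∈ S) (hp : cl p = false) (hθ : ∀ t ∈ S, cl t → θ t ≠ p)
    (hσ' : ∀ t ∈ S, t ≠ p → σ' t = if σ t = p then σ p else σ t)
    (hσp : ∀ t ∈ S, t ≠ p → σ t = p → σ p ≠ p) :
    Balanced {t | t ∈ S ∧ t ≠ p} σ' θ cl ↔ Balanced S σ θ cl := by
  constructor
  · intro h κ hκ
    obtain ⟨f, hf⟩ := h κ (by
      rintro t ⟨ht, htp⟩
      rw [hσ' t ht htp, ← hκ t ht]
      split_ifs with h1
      · rw [h1, hκ p hpS]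
      · rfl)
    -- Colours pass straight through `p`, so the colour after `p` must also be the one before it. If
    -- `σ p = p`, the circle carries nothing else and any colour works.
    refine ⟨Function.update f p (f (σ p)), fun t ht => ?_⟩
    have hcongr : t ≠ p → outColour θ cl κ (Function.update f p (f (σ p))) t =
        outColour θ cl κ f t := fun htp =>
      outColour_congr rfl (fun _ => rfl) (Function.update_of_ne htp _ _)
        (fun h => Function.update_of_ne (hθ t ht h) _ _)
    by_cases htp : t = p
    · subst htp
      by_cases h1 : σ t = t <;> simp [outColour, hp, h1]
    · rw [hcongr htp, ← hf t ⟨ht, htp⟩, hσ' t ht htp]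
      split_ifs with h1
      · rw [h1, Function.update_self]
      · rw [Function.update_of_ne h1]
  · intro h κ hκ
    have key : ∀ t ∈ S, t ≠ p → σ t = p → κ (σ p) = κ t := by
      intro t ht htp h1
      have := hκ t ⟨ht, htp⟩
      rwa [hσ' t ht htp, if_pos h1] at this
    -- The label at `p` is arbitrary in the erased code, so it is reset to that of its component.
    obtain ⟨f, hf⟩ := h (Function.update κ p (κ (σ p))) (by
      intro t ht
      by_cases htp : t = p
      · subst htp
        by_cases h1 : σ t = t <;> simp [h1]
      · rw [Function.update_of_ne htp]
        by_cases h1 : σ t = p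
        · rw [h1, Function.update_self, key t ht htp h1]
        · rw [Function.update_of_ne h1]
          have := hκ t ⟨ht, htp⟩
          rwa [hσ' t ht htp, if_neg h1] at this)
    refine ⟨f, fun t ht => ?_⟩
    have h2 := hf t ht.1
    have h3 : outColour θ cl (Function.update κ p (κ (σ p))) f t = outColour θ cl κ f t := by
      unfold outColour
      cases h : cl t
      · rfl
      · rw [Function.update_of_ne ht.2, Function.update_of_ne (hθ t ht.1 h)]
    rw [h3] at h2
    rw [← h2, hσ' t ht.1 ht.2]
    split_ifs with h1
    · rw [hf p hpS, h1]
      simp [outColour, hp]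
    · rfl

end Balanced

/-! ### Recolouring inside a kink, a bigon and a triangle -/

section LocalMoves

variable {α : Type*} [DecidableEq α] {S : Set α} {σ θ : α → α} {cl cl' : α → Bool}

/-- The status of the crossing of a kink does not matter. -/
theorem Balanced.kink (h : Balanced S σ θ cl) (hσ : σ.Injective) {p q : α} (hp : p ∈ S) (hq : q ∈ S)
    (hpq : p ≠ q) (hs : σ p = q) (hθp : θ p = q) (hθq : θ q = p)
    (hθ : ∀ t, t ≠ p → t ≠ q → θ t ≠ p ∧ θ t ≠ q)
    (hcl : cl p = cl q) (hcl' : cl' p = cl' q) (hoff : ∀ t, t ≠ p → t ≠ q → cl' t = cl t) :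
    Balanced S σ θ cl' := by
  refine h.of_local {q} {p, q} (by simp) (fun t _ ht => ?_) (fun t _ ht => ?_) fun κ f hκ hf => ?_
  · exact Or.inl (hσ (by simpa [hs] using ht))
  · simp only [Set.mem_insert_iff, Set.mem_singleton_iff, not_or] at ht ⊢
    exact ⟨hoff t ht.1 ht.2, fun _ => ⟨trivial, hθ t ht.1 ht.2⟩⟩
  · have h1 := hf p hp
    have h2 := hf q hq
    have h3 := hκ p hp
    have hqq : σ q ≠ q := fun e => hpq (hσ (by rw [e, hs]))
    refine ⟨Function.update f q (f p), fun t ht => Function.update_of_ne ht _ _, ?_⟩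
    simp only [Set.mem_insert_iff, Set.mem_singleton_iff, forall_eq_or_imp, forall_eq, outColour,
      hs, hθp, hθq, hcl, hcl', Function.update_self, Function.update_of_ne hpq,
      Function.update_of_ne hqq] at h1 h2 h3 ⊢
    rw [h3] at h1 h2 ⊢
    revert h1 h2
    cases cl q <;> cases cl' q <;> simp +contextual

/-- Only the number of classical crossings of a coherent bigon matters, modulo `2`. -/
theorem Balanced.coherentBigon (h : Balanced S σ θ cl) (hσ : σ.Injective) {p₁ q₁ p₂ q₂ : α}
    (hp₁ : p₁ ∈ S) (hq₁ : q₁ ∈ S) (hp₂ : p₂ ∈ S) (hq₂ : q₂ ∈ S) (hnd : [p₁, q₁, p₂, q₂].Nodup)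
    (hs₁ : σ p₁ = q₁) (hs₂ : σ p₂ = q₂) (hθp₁ : θ p₁ = p₂) (hθp₂ : θ p₂ = p₁)
    (hθq₁ : θ q₁ = q₂) (hθq₂ : θ q₂ = q₁)
    (hθ : ∀ t ∉ [p₁, q₁, p₂, q₂], θ t ∉ [p₁, q₁, p₂, q₂])
    (hclp : cl p₁ = cl p₂) (hclq : cl q₁ = cl q₂) (hclp' : cl' p₁ = cl' p₂)
    (hclq' : cl' q₁ = cl' q₂) (hxor : (cl' p₁ ^^ cl' q₁) = (cl p₁ ^^ cl q₁))
    (hoff : ∀ t ∉ [p₁, q₁, p₂, q₂], cl' t = cl t) :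
    Balanced S σ θ cl' := by
  have hnd' := hnd
  simp only [List.nodup_cons, List.mem_cons, not_or, List.not_mem_nil, not_false_eq_true,
    and_true, List.nodup_nil] at hnd'
  obtain ⟨⟨n1, n2, n3⟩, ⟨n4, n5⟩, n6⟩ := hnd'
  refine h.of_local {q₁, q₂} {t | t ∈ [p₁, q₁, p₂, q₂]} ?_ (fun t _ ht => ?_) (fun t _ ht => ?_)
    fun κ f hκ hf => ?_
  · intro t
    simp only [Set.mem_insert_iff, Set.mem_singleton_iff, List.mem_cons, Set.mem_ofPred_eq]
    tauto
  · rcases ht with ht | ht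
    · simp [hσ (ht.trans hs₁.symm)]
    · simp [hσ (Eq.trans ht hs₂.symm)]
  · exact ⟨hoff t ht, fun _ => ⟨rfl, hθ t ht⟩⟩
  · have a1 := hf p₁ hp₁
    have a2 := hf q₁ hq₁
    have a3 := hf p₂ hp₂
    have a4 := hf q₂ hq₂
    have k1 := hκ p₁ hp₁
    have k2 := hκ p₂ hp₂
    have m1 : σ q₁ ≠ q₁ := fun e => n1 (hσ (by rw [e, hs₁]))
    have m2 : σ q₁ ≠ q₂ := fun e => n4 (hσ (by rw [e, hs₂]))
    have m3 : σ q₂ ≠ q₁ := fun e => n3 (hσ (by rw [e, hs₁]))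
    have m4 : σ q₂ ≠ q₂ := fun e => n6 (hσ (by rw [e, hs₂]))
    -- The incoming colours force the two inner colours. The outgoing ones agree because the
    -- crossing map is an involution; this is a check over Booleans.
    refine ⟨Function.update (Function.update f q₁ (outColour θ cl' κ f p₁)) q₂
      (outColour θ cl' κ f p₂), fun t ht => ?_, ?_⟩
    · simp only [Set.mem_insert_iff, Set.mem_singleton_iff, not_or] at ht
      rw [Function.update_of_ne ht.2, Function.update_of_ne ht.1]
    · simp only [Set.mem_ofPred_eq, List.mem_cons, List.not_mem_nil, or_false, forall_eq_or_imp,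
        forall_eq, outColour, Function.update_apply, hs₁, hs₂, hθp₁, hθp₂, hθq₁, hθq₂, n1, n3,
        Ne.symm n4, n5, n6, m1, m2, m3, m4, if_true, if_false] at a1 a2 a3 a4 k1 k2 ⊢
      rw [a2, a4, a1, a3, k1, k2, ← hclp, ← hclq, ← hclp', ← hclq']
      generalize f p₁ = x at *
      generalize f p₂ = y at *
      generalize κ p₁ = u at *
      generalize κ p₂ = v at *
      clear * - hxor
      revert hxor
      generalize cl p₁ = a, cl q₁ = b, cl' p₁ = c, cl' q₁ = d
      revert x y u v a b c d
      decide

/-- The two crossings of an incoherent bigon can be exchanged if one of them is virtual. -/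
theorem Balanced.incoherentBigon (h : Balanced S σ θ cl) (hσ : σ.Injective) {p₁ q₁ p₂ q₂ : α}
    (hp₁ : p₁ ∈ S) (hq₁ : q₁ ∈ S) (hp₂ : p₂ ∈ S) (hq₂ : q₂ ∈ S) (hnd : [p₁, q₁, p₂, q₂].Nodup)
    (hs₁ : σ p₁ = q₁) (hs₂ : σ p₂ = q₂) (hθp₁ : θ p₁ = q₂) (hθq₂ : θ q₂ = p₁)
    (hθq₁ : θ q₁ = p₂) (hθp₂ : θ p₂ = q₁)
    (hθ : ∀ t ∉ [p₁, q₁, p₂, q₂], θ t ∉ [p₁, q₁, p₂, q₂])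
    (hcp₁ : cl p₁ = true) (hcq₁ : cl q₁ = false) (hcp₂ : cl p₂ = false) (hcq₂ : cl q₂ = true)
    (hcp₁' : cl' p₁ = false) (hcq₁' : cl' q₁ = true) (hcp₂' : cl' p₂ = true)
    (hcq₂' : cl' q₂ = false) (hoff : ∀ t ∉ [p₁, q₁, p₂, q₂], cl' t = cl t) :
    Balanced S σ θ cl' := by
  have hnd' := hnd
  simp only [List.nodup_cons, List.mem_cons, not_or, List.not_mem_nil, not_false_eq_true,
    and_true, List.nodup_nil] at hnd'
  obtain ⟨⟨n1, n2, n3⟩, ⟨n4, n5⟩, n6⟩ := hnd'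
  refine h.of_local {q₁, q₂} {t | t ∈ [p₁, q₁, p₂, q₂]} ?_ (fun t _ ht => ?_) (fun t _ ht => ?_)
    fun κ f hκ hf => ?_
  · intro t
    simp only [Set.mem_insert_iff, Set.mem_singleton_iff, List.mem_cons, Set.mem_ofPred_eq]
    tauto
  · rcases ht with ht | ht
    · simp [hσ (ht.trans hs₁.symm)]
    · simp [hσ (Eq.trans ht hs₂.symm)]
  · exact ⟨hoff t ht, fun _ => ⟨rfl, hθ t ht⟩⟩
  · have a1 := hf p₁ hp₁
    have a2 := hf q₁ hq₁
    have a3 := hf p₂ hp₂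
    have a4 := hf q₂ hq₂
    have k1 := hκ p₁ hp₁
    have k2 := hκ p₂ hp₂
    have m1 : σ q₁ ≠ q₁ := fun e => n1 (hσ (by rw [e, hs₁]))
    have m2 : σ q₁ ≠ q₂ := fun e => n4 (hσ (by rw [e, hs₂]))
    have m3 : σ q₂ ≠ q₁ := fun e => n3 (hσ (by rw [e, hs₁]))
    have m4 : σ q₂ ≠ q₂ := fun e => n6 (hσ (by rw [e, hs₂]))
    -- Now `p₁` is virtual, so `q₁` inherits `f p₁`. At `p₂` the partner is `q₁`, so equal labels
    -- pass on this same colour `f p₁`.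
    refine ⟨Function.update (Function.update f q₁ (f p₁)) q₂
      (bif κ p₁ == κ p₂ then f p₁ else !f p₂), fun t ht => ?_, ?_⟩
    · simp only [Set.mem_insert_iff, Set.mem_singleton_iff, not_or] at ht
      rw [Function.update_of_ne ht.2, Function.update_of_ne ht.1]
    · simp only [Set.mem_ofPred_eq, List.mem_cons, List.not_mem_nil, or_false, forall_eq_or_imp,
        forall_eq, outColour, Function.update_apply, hs₁, hs₂, hθp₁, hθp₂, hθq₁, hθq₂, n1, n3,
        Ne.symm n4, n5, n6, m1, m2, m3, m4, if_true, if_false, hcp₁, hcq₁, hcp₂, hcq₂, hcp₁',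
        hcq₁', hcp₂', hcq₂', cond_true, cond_false] at a1 a2 a3 a4 k1 k2 ⊢
      rw [a2, a4, a1, a3, k1, k2]
      generalize f p₁ = x
      generalize f p₂ = y
      generalize κ p₁ = u
      generalize κ p₂ = v
      clear * -
      revert x y u v
      decide

/-- Three strands `pᵢ → qᵢ` form a triangle whose boundary is not a directed cycle; moving a strand
across the opposite crossing changes the pairing of the passages from `θ` to `θ'`. -/
theorem Balanced.triangle {θ' : α → α} (h : Balanced S σ θ cl) (hσ : σ.Injective)
    {p₁ q₁ p₂ q₂ p₃ q₃ : α} (hS : ∀ t ∈ [p₁, q₁, p₂, q₂, p₃, q₃], t ∈ S)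
    (hnd : [p₁, q₁, p₂, q₂, p₃, q₃].Nodup)
    (hs₁ : σ p₁ = q₁) (hs₂ : σ p₂ = q₂) (hs₃ : σ p₃ = q₃)
    (hθp₁ : θ p₁ = p₂) (hθp₂ : θ p₂ = p₁) (hθq₁ : θ q₁ = p₃) (hθp₃ : θ p₃ = q₁)
    (hθq₂ : θ q₂ = q₃) (hθq₃ : θ q₃ = q₂)
    (hθp₁' : θ' p₁ = q₃) (hθq₃' : θ' q₃ = p₁) (hθp₂' : θ' p₂ = p₃) (hθp₃' : θ' p₃ = p₂)
    (hθq₁' : θ' q₁ = q₂) (hθq₂' : θ' q₂ = q₁)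
    (hθ : ∀ t ∉ [p₁, q₁, p₂, q₂, p₃, q₃], θ' t = θ t ∧ θ t ∉ [p₁, q₁, p₂, q₂, p₃, q₃])
    (hcl : ∀ t ∈ [p₁, q₁, p₂, q₂, p₃, q₃], cl t = true) :
    Balanced S σ θ' cl := by
  have hnd' := hnd
  simp only [List.nodup_cons, List.mem_cons, not_or, List.not_mem_nil, not_false_eq_true,
    and_true, List.nodup_nil] at hnd'
  obtain ⟨⟨n1, n2, n3, n4, n5⟩, ⟨n6, n7, n8, n9⟩, ⟨n10, n11, n12⟩, ⟨n13, n14⟩, n15⟩ := hnd'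
  refine h.of_local {q₁, q₂, q₃} {t | t ∈ [p₁, q₁, p₂, q₂, p₃, q₃]} ?_ (fun t _ ht => ?_)
    (fun t _ ht => ⟨rfl, fun _ => hθ t ht⟩) fun κ f hκ hf => ?_
  · intro t
    simp only [Set.mem_insert_iff, Set.mem_singleton_iff, List.mem_cons, Set.mem_ofPred_eq]
    tauto
  · rcases ht with ht | ht | ht
    · simp [hσ (ht.trans hs₁.symm)]
    · simp [hσ (Eq.trans ht hs₂.symm)]
    · simp [hσ (Eq.trans ht hs₃.symm)]
  · simp only [List.mem_cons, List.not_mem_nil, or_false, forall_eq_or_imp, forall_eq] at hS hcl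
    obtain ⟨s1, s2, s3, s4, s5, s6⟩ := hS
    obtain ⟨c1, c2, c3, c4, c5, c6⟩ := hcl
    have a1 := hf p₁ s1
    have a2 := hf q₁ s2
    have a3 := hf p₂ s3
    have a4 := hf q₂ s4
    have a5 := hf p₃ s5
    have a6 := hf q₃ s6
    have k1 := hκ p₁ s1
    have k2 := hκ p₂ s3
    have k3 := hκ p₃ s5
    have hm : ∀ t, t ≠ p₁ → t ≠ p₂ → t ≠ p₃ → σ t ≠ q₁ ∧ σ t ≠ q₂ ∧ σ t ≠ q₃ :=
      fun t h1 h2 h3 => ⟨fun e => h1 (hσ (by rw [e, hs₁])), fun e => h2 (hσ (by rw [e, hs₂])),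
        fun e => h3 (hσ (by rw [e, hs₃]))⟩
    obtain ⟨m1, m2, m3⟩ := hm q₁ (Ne.symm n1) n6 n8
    obtain ⟨m4, m5, m6⟩ := hm q₂ (Ne.symm n3) (Ne.symm n10) n13
    obtain ⟨m7, m8, m9⟩ := hm q₃ (Ne.symm n5) (Ne.symm n12) (Ne.symm n15)
    -- Since the triangle is not a directed cycle, the inner colours can be computed in succession:
    -- `q₂` and `q₃` from the crossing of `p₂` and `p₃`, then `q₁` from the crossing of `p₁` and
    -- `q₃`. That the outgoing colours agree is the Yang–Baxter relation, checked by `decide`.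
    refine ⟨Function.update (Function.update (Function.update f q₁
      (bif κ p₁ == κ p₃ then (bif κ p₃ == κ p₂ then f p₂ else !f p₃) else !f p₁)) q₂
      (bif κ p₂ == κ p₃ then f p₃ else !f p₂)) q₃ (bif κ p₃ == κ p₂ then f p₂ else !f p₃),
      fun t ht => ?_, ?_⟩
    · simp only [Set.mem_insert_iff, Set.mem_singleton_iff, not_or] at ht
      rw [Function.update_of_ne ht.2.2, Function.update_of_ne ht.2.1, Function.update_of_ne ht.1]
    · simp only [Set.mem_ofPred_eq, List.mem_cons, List.not_mem_nil, or_false, forall_eq_or_imp,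
        forall_eq, outColour, Function.update_apply, hs₁, hs₂, hs₃, hθp₁, hθp₂, hθq₁, hθp₃, hθq₂,
        hθq₃, hθp₁', hθq₃', hθp₂', hθp₃', hθq₁', hθq₂', n1, n3, n5, Ne.symm n6, Ne.symm n8, n7, n9,
        n10, n12, Ne.symm n13, n14, n15, m1, m2, m3, m4, m5, m6, m7, m8, m9, c1, c2, c3, c4, c5,
        c6, if_true, if_false, cond_true] at a1 a2 a3 a4 a5 a6 k1 k2 k3 ⊢
      rw [a2, a4, a6, a5, a1, a3, k1, k2, k3]
      generalize f p₁ = x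
      generalize f p₂ = y
      generalize f p₃ = z
      generalize κ p₁ = u
      generalize κ p₂ = v
      generalize κ p₃ = w
      clear * -
      revert x y z u v w
      decide

end LocalMoves

/-! ### Cyclic words and erasure of passages -/

theorem formPerm_map_apply {α β : Type*} [DecidableEq α] [DecidableEq β] (E : α ≃ β) {w : List α}
    (hw : w.Nodup) {t : α} (ht : t ∈ w) :
    (w.map E).formPerm (E t) = E (w.formPerm t) := by
  obtain ⟨i, hi, rfl⟩ := List.getElem_of_mem ht
  have h := List.formPerm_apply_getElem (w.map E) (hw.map E.injective) i (by simpa using hi)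
  simpa [List.formPerm_apply_getElem w hw i hi] using h

theorem formPerm_cons_apply_of_ne {α : Type*} [DecidableEq α] {p t : α} {l : List α}
    (hw : (p :: l).Nodup) (ht : t ≠ p) :
    l.formPerm t =
      if (p :: l).formPerm t = p then (p :: l).formPerm p else (p :: l).formPerm t := by
  cases l with
  | nil => simp [ht]
  | cons a l =>
    have hpa : p ≠ a := fun h => by simp [h] at hw
    have h1 : (a :: l).formPerm p = p :=
      List.formPerm_apply_of_notMem (List.nodup_cons.1 hw).1
    simp only [List.formPerm_cons_cons, Equiv.Perm.mul_apply, h1, Equiv.swap_apply_left]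
    set s := (a :: l).formPerm t with hs
    have hsp : s ≠ p := fun h => ht ((a :: l).formPerm.injective (by rw [h1, ← hs, h]))
    by_cases h2 : s = a
    · simp [h2]
    · rw [Equiv.swap_apply_of_ne_of_ne hsp h2, if_neg hsp]

theorem formPerm_filter_ne_apply {α : Type*} [DecidableEq α] {p t : α} {w : List α}
    (hw : w.Nodup) (ht : t ∈ w) (htp : t ≠ p) :
    (w.filter (· ≠ p)).formPerm t = if w.formPerm t = p then w.formPerm p else w.formPerm t := by
  by_cases hp : p ∈ w
  · obtain ⟨l₁, l₂, rfl⟩ := List.append_of_mem hp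
    -- Rotating `p` to the front reduces the claim to `formPerm_cons_apply_of_ne`.
    have hrot : (l₁ ++ p :: l₂) ~r (p :: (l₂ ++ l₁)) := by
      have := List.isRotated_append (l := l₁) (l' := p :: l₂)
      simpa using this
    have hw' := hrot.nodup_iff.1 hw
    have hfil : (l₁ ++ p :: l₂).filter (· ≠ p) = l₁ ++ l₂ := by
      have h1 := (List.nodup_cons.1 hw').1
      simp only [List.mem_append, not_or] at h1
      rw [List.filter_append, List.filter_cons_of_neg (by simp)]
      rw [List.filter_eq_self.2, List.filter_eq_self.2]
      · intro a ha
        simpa using fun h : a = p => h1.1 (h ▸ ha)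
      · intro a ha
        simpa using fun h : a = p => h1.2 (h ▸ ha)
    have hn : (l₁ ++ l₂).Nodup := by rw [← hfil]; exact hw.filter _
    rw [hfil, List.formPerm_eq_of_isRotated hn List.isRotated_append,
      List.formPerm_eq_of_isRotated hw hrot]
    exact formPerm_cons_apply_of_ne hw' htp
  · rw [List.filter_eq_self.2, if_neg]
    · exact fun h => hp (h ▸ List.formPerm_apply_mem_of_mem ht)
    · intro a ha
      simpa using fun h : a = p => hp (h ▸ ha)

theorem mem_passages {W : List (List Passage)} {p : Passage} :
    p ∈ passages W ↔ ∃ w ∈ W, p ∈ w := List.mem_flatten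

theorem succ_apply_of_notMem {W : List (List Passage)} {p : Passage} (hp : p ∉ passages W) :
    succ W p = p := by
  induction W with
  | nil => rfl
  | cons w W ih =>
    simp only [passages, List.flatten_cons, List.mem_append, not_or] at hp
    have h : succ (w :: W) p = w.formPerm (succ W p) := by simp [succ]
    rw [h, ih hp.2, List.formPerm_apply_of_notMem hp.1]

theorem succ_apply {W : List (List Passage)} (hW : (passages W).Nodup) {w : List Passage}
    (hw : w ∈ W) {p : Passage} (hp : p ∈ w) : succ W p = w.formPerm p := by
  induction W with
  | nil => simp at hw
  | cons v W ih =>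
    have h : succ (v :: W) p = v.formPerm (succ W p) := by simp [succ]
    simp only [passages, List.flatten_cons, List.nodup_append'] at hW
    rw [h]
    rcases List.mem_cons.1 hw with rfl | hw
    · rw [succ_apply_of_notMem (hW.2.2 hp)]
    · rw [ih hW.2.1 hw]
      refine List.formPerm_apply_of_notMem fun h => hW.2.2 h ?_
      exact mem_passages.2 ⟨w, hw, List.formPerm_apply_mem_of_mem hp⟩

theorem nodup_of_mem {W : List (List Passage)} (hW : (passages W).Nodup) {w : List Passage}
    (hw : w ∈ W) : w.Nodup := (List.nodup_flatten.1 hW).1 w hw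

theorem succ_mem {W : List (List Passage)} (hW : (passages W).Nodup) {p : Passage}
    (hp : p ∈ passages W) : succ W p ∈ passages W := by
  obtain ⟨w, hw, hpw⟩ := mem_passages.1 hp
  rw [succ_apply hW hw hpw]
  exact mem_passages.2 ⟨w, hw, List.formPerm_apply_mem_of_mem hpw⟩

theorem passages_map_filter (W : List (List Passage)) (P : Passage → Bool) :
    passages (W.map (List.filter P)) = (passages W).filter P := by
  simp [passages, List.filter_flatten]

theorem succ_filter_ne_apply {W : List (List Passage)} (hW : (passages W).Nodup) {p t : Passage}
    (ht : t ∈ passages W) (htp : t ≠ p) :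
    succ (W.map (List.filter (· ≠ p))) t =
      if succ W t = p then succ W p else succ W t := by
  obtain ⟨w, hw, htw⟩ := mem_passages.1 ht
  have hn : (passages (W.map (List.filter (· ≠ p)))).Nodup := by
    rw [passages_map_filter]
    exact hW.filter _
  rw [succ_apply hn (List.mem_map_of_mem hw) (by simpa using ⟨htw, htp⟩), succ_apply hW hw htw,
    formPerm_filter_ne_apply (nodup_of_mem hW hw) htw htp]
  split_ifs with h
  · rw [succ_apply hW hw (h ▸ List.formPerm_apply_mem_of_mem htw)]
  · rfl

/-- The code `W` with classical passages `cl` is balanced. -/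
def BalancedCode (W : List (List Passage)) (cl : Passage → Bool) : Prop :=
  Balanced {p | p ∈ passages W} (succ W) opp cl

theorem BalancedCode.congr {W : List (List Passage)} {cl cl' : Passage → Bool}
    (h : BalancedCode W cl) (hcl : ∀ p ∈ passages W, cl' p = cl p) : BalancedCode W cl' :=
  Balanced.transport h (Equiv.refl _) (fun _ h => h) (fun _ h => h) (fun _ _ => rfl)
    (fun p hp => (hcl p hp).symm) fun _ _ => rfl

theorem balancedCode_filter_ne_iff {W : List (List Passage)} (hW : (passages W).Nodup)
    {cl : Passage → Bool} (hcl : ∀ p, cl (opp p) = cl p) {p : Passage} (hp : cl p = false) :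
    BalancedCode (W.map (List.filter (· ≠ p))) cl ↔ BalancedCode W cl := by
  by_cases hpW : p ∈ passages W
  · have hS : {t | t ∈ passages (W.map (List.filter (· ≠ p)))} =
        {t | t ∈ {t | t ∈ passages W} ∧ t ≠ p} := by
      ext t
      simp [passages_map_filter]
    rw [BalancedCode, BalancedCode, hS]
    refine balanced_erase_iff hpW hp (fun t _ ht h => ?_)
      (fun t ht htp => succ_filter_ne_apply hW ht htp) fun t _ htp h1 h2 => ?_
    · rw [← hcl, h, hp] at ht
      exact Bool.false_ne_true ht
    · exact htp ((succ W).injective (h1.trans h2.symm))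
  · have : W.map (List.filter (· ≠ p)) = W := by
      conv_rhs => rw [← List.map_id W]
      refine List.map_congr_left fun w hw => List.filter_eq_self.2 fun a ha => ?_
      simpa using fun h : a = p => hpW (mem_passages.2 ⟨w, hw, h ▸ ha⟩)
    rw [this]

/-- Virtual passages can be erased one at a time. The intermediate codes may contain one passage of
a crossing without the other, which is harmless because partners matter only at classical passages.
-/
theorem balancedCode_filter_iff {W : List (List Passage)} (hW : (passages W).Nodup)
    {cl P : Passage → Bool} (hcl : ∀ p, cl (opp p) = cl p)
    (hP : ∀ p ∈ passages W, P p = false → cl p = false) :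
    BalancedCode (W.map (List.filter P)) cl ↔ BalancedCode W cl := by
  have key : ∀ E : List Passage, (∀ p ∈ E, cl p = false) →
      (BalancedCode (W.map (List.filter (· ∉ E))) cl ↔ BalancedCode W cl) := by
    intro E
    induction E with
    | nil =>
      intro _
      have : (List.filter (· ∉ ([] : List Passage)) : List Passage → _) = id := by
        funext w
        simp
      rw [this, List.map_id]
    | cons p E ih =>
      intro hE
      rw [← ih fun q hq => hE q (List.mem_cons_of_mem _ hq),
        ← balancedCode_filter_ne_iff (W := W.map (List.filter (· ∉ E))) (p := p) _ hcl
          (hE p List.mem_cons_self)]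
      · rw [List.map_map]
        have : (List.filter (· ∉ p :: E) : List Passage → _) =
            List.filter (· ≠ p) ∘ List.filter (· ∉ E) := by
          funext w
          simp [List.filter_filter]
        rw [this]
      · rw [passages_map_filter]
        exact hW.filter _
  rw [← key ((passages W).filter fun p => !P p) (by simpa using hP)]
  have : W.map (List.filter P) =
      W.map (List.filter (· ∉ (passages W).filter fun p => !P p)) := by
    refine List.map_congr_left fun w hw => List.filter_congr fun p hp => ?_
    have := mem_passages.2 ⟨w, hw, hp⟩
    simp [this]
  rw [this]

variable {T : LinkTheory}

/-! ### Invariance under the allowed moves -/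

namespace Diagram

/-- `D.classical p` holds if the crossing of the passage `p` is classical. -/
def classical (D : Diagram T) (p : Passage) : Bool := (D.info p.1).isSome

/-- The invariant of braid-like equivalence. -/
def IsBalanced (D : Diagram T) : Prop := BalancedCode D.words D.classical

theorem hasCrossing_of_mem (D : Diagram T) {p : Passage} (hp : p ∈ passages D.words) :
    D.HasCrossing p.1 := by
  obtain ⟨c, r⟩ := p
  cases r
  · exact D.opp_mem _ hp
  · exact hp

theorem mem_of_hasCrossing (D : Diagram T) {c : ℕ} (hc : D.HasCrossing c) (r : Bool) :
    (c, r) ∈ passages D.words := by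
  cases r
  · exact D.opp_mem _ hc
  · exact hc

/-- Erasing crossings has the same effect as declaring them virtual. The first two Reidemeister
moves thereby become changes of status on the fixed code of `D'`. -/
theorem IsErasure.isBalanced_iff {s : Finset ℕ} {D D' : Diagram T} (h : IsErasure s D D') :
    BalancedCode D'.words (fun p => decide (p.1 ∉ s) && D'.classical p) ↔ D.IsBalanced := by
  rw [← balancedCode_filter_iff D'.nodup (P := fun p => decide (p.1 ∉ s)) (fun _ => rfl)
    (fun p _ hp => by simp [hp])]
  obtain ⟨hw, hi⟩ := h
  have hw' : D'.words.map (List.filter fun p => decide (p.1 ∉ s)) = D.words := hw.symm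
  rw [hw']
  have key : ∀ p ∈ passages D.words,
      (decide (p.1 ∉ s) && D'.classical p) = D.classical p := by
    intro p hp
    have h1 := hp
    rw [← hw', passages_map_filter, List.mem_filter] at h1
    rw [h1.2, Bool.true_and, classical, classical, hi _ (D.hasCrossing_of_mem hp)]
  exact ⟨fun h => h.congr fun p hp => (key p hp).symm, fun h => h.congr key⟩

theorem R1.isBalanced_iff {D D' : Diagram T} (h : R1 D D') : D.IsBalanced ↔ D'.IsBalanced := by
  obtain ⟨c, r, ⟨hp, hs⟩, -, he⟩ := h
  rw [← he.isBalanced_iff]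
  have hq : (c, !r) ∈ passages D'.words := D'.opp_mem _ hp
  have key : ∀ cl cl' : Passage → Bool, cl (c, r) = cl (c, !r) → cl' (c, r) = cl' (c, !r) →
      (∀ t : Passage, t.1 ≠ c → cl' t = cl t) →
      BalancedCode D'.words cl → BalancedCode D'.words cl' := by
    intro cl cl' hcl hcl' hoff h
    have hne : ∀ t : Passage, t ≠ (c, r) → t ≠ (c, !r) → t.1 ≠ c := by
      rintro ⟨d, e⟩ h1 h2 rfl
      cases e <;> cases r <;> simp at h1 h2
    refine Balanced.kink h (succ D'.words).injective hp hq (by simp) hs rfl (by simp [opp])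
      (fun t h1 h2 => ?_) hcl hcl' fun t h1 h2 => hoff t (hne t h1 h2)
    have := hne t h1 h2
    constructor <;> exact fun h => this (congrArg Prod.fst h)
  refine ⟨key _ _ rfl rfl ?_, key _ _ rfl rfl ?_⟩ <;>
  · intro t ht
    simp [ht]

theorem CoherentBigon.balancedCode {D : Diagram T} {x y : ℕ} {r : Bool}
    (hb : D.CoherentBigon x y r) {cl cl' : ℕ → Bool}
    (h : BalancedCode D.words fun p => cl p.1) (hxor : (cl' x ^^ cl' y) = (cl x ^^ cl y))
    (hoff : ∀ c, c ≠ x → c ≠ y → cl' c = cl c) : BalancedCode D.words fun p => cl' p.1 := by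
  obtain ⟨hxy, ⟨h1, h2⟩, h3, h4⟩ := hb
  have hout : ∀ t : Passage, t ∉ [(x, r), (y, !r), (x, !r), (y, r)] ↔ t.1 ≠ x ∧ t.1 ≠ y := by
    rintro ⟨d, e⟩
    cases e <;> cases r <;> simp <;> tauto
  refine Balanced.coherentBigon h (succ D.words).injective h1 (h2 ▸ succ_mem D.nodup h1) h3
    (h4 ▸ succ_mem D.nodup h3) ?_ h2 h4 (by simp [opp]) (by simp [opp]) (by simp [opp])
    (by simp [opp]) (fun t ht => ?_) rfl rfl rfl rfl hxor fun t ht => ?_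
  · cases r <;> simp [hxy, Ne.symm hxy]
  · rw [hout] at ht ⊢
    exact ht
  · rw [hout] at ht
    exact hoff _ ht.1 ht.2

theorem BraidLikeR2.isBalanced_iff {D D' : Diagram T} (h : BraidLikeR2 D D') :
    D.IsBalanced ↔ D'.IsBalanced := by
  obtain ⟨x, y, r, hb, ⟨i, j, hi, hj, -⟩, he⟩ := h
  rw [← he.isBalanced_iff]
  constructor <;> intro h
  · refine hb.balancedCode (cl := fun c => decide (c ∉ ({x, y} : Finset ℕ)) && (D'.info c).isSome)
      (cl' := fun c => (D'.info c).isSome) h ?_ fun c h1 h2 => ?_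
    · simp [hi, hj]
    · simp [h1, h2]
  · refine hb.balancedCode (cl := fun c => (D'.info c).isSome)
      (cl' := fun c => decide (c ∉ ({x, y} : Finset ℕ)) && (D'.info c).isSome) h ?_
      fun c h1 h2 => ?_
    · simp [hi, hj]
    · simp [h1, h2]

theorem IncoherentBigon.balancedCode {D : Diagram T} {x y : ℕ} {r : Bool}
    (hb : D.IncoherentBigon x y r) {cl cl' : ℕ → Bool}
    (h : BalancedCode D.words fun p => cl p.1) (hx : cl x = true) (hy : cl y = false)
    (hx' : cl' x = false) (hy' : cl' y = true)
    (hoff : ∀ c, c ≠ x → c ≠ y → cl' c = cl c) : BalancedCode D.words fun p => cl' p.1 := by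
  obtain ⟨hxy, ⟨h1, h2⟩, h3, h4⟩ := hb
  have hout : ∀ t : Passage, t ∉ [(x, r), (y, !r), (y, r), (x, !r)] ↔ t.1 ≠ x ∧ t.1 ≠ y := by
    rintro ⟨d, e⟩
    cases e <;> cases r <;> simp <;> tauto
  refine Balanced.incoherentBigon h (succ D.words).injective h1 (h2 ▸ succ_mem D.nodup h1) h3
    (h4 ▸ succ_mem D.nodup h3) ?_ h2 h4 (by simp [opp]) (by simp [opp]) (by simp [opp])
    (by simp [opp]) (fun t ht => ?_) hx hy hy hx hx' hy' hy' hx' fun t ht => ?_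
  · cases r <;> simp [hxy, Ne.symm hxy]
  · rw [hout] at ht ⊢
    exact ht
  · rw [hout] at ht
    exact hoff _ ht.1 ht.2

theorem Virtualization.isBalanced_iff {D D' : Diagram T} (h : Virtualization D D') :
    D.IsBalanced ↔ D'.IsBalanced := by
  obtain ⟨z, v, r, hb, ⟨i, hz⟩, hv, hw, hinfo⟩ := h
  have hcl : ∀ p ∈ passages D.words, D'.classical p = (D.info (Equiv.swap z v p.1)).isSome :=
    fun p hp => by rw [classical, hinfo _ (D.hasCrossing_of_mem hp)]
  have hD' : D'.IsBalanced ↔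
      BalancedCode D.words fun p => (D.info (Equiv.swap z v p.1)).isSome := by
    rw [IsBalanced, hw]
    exact ⟨fun h => h.congr fun p hp => (hcl p hp).symm, fun h => h.congr hcl⟩
  have hD : D.IsBalanced ↔ BalancedCode D.words fun p => (D.info p.1).isSome := Iff.rfl
  rw [hD', hD]
  have hoff : ∀ c, c ≠ z → c ≠ v → (D.info (Equiv.swap z v c)).isSome = (D.info c).isSome :=
    fun c h1 h2 => by rw [Equiv.swap_apply_of_ne_of_ne h1 h2]
  have hsz : (D.info (Equiv.swap z v z)).isSome = false := by simp [hv]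
  have hsv : (D.info (Equiv.swap z v v)).isSome = true := by simp [hz]
  have hz' : (D.info z).isSome = true := by simp [hz]
  have hv' : (D.info v).isSome = false := by simp [hv]
  rcases hb with hb | hb | hb
  · exact ⟨fun h => hb.balancedCode (cl := fun c => (D.info c).isSome)
        (cl' := fun c => (D.info (Equiv.swap z v c)).isSome) h
        (by simp only [hsz, hsv, hz', hv']; rfl) hoff,
      fun h => hb.balancedCode (cl' := fun c => (D.info c).isSome)
        (cl := fun c => (D.info (Equiv.swap z v c)).isSome) h
        (by simp only [hsz, hsv, hz', hv']; rfl) fun c h1 h2 => (hoff c h1 h2).symm⟩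
  · exact ⟨fun h => hb.balancedCode (cl := fun c => (D.info c).isSome)
        (cl' := fun c => (D.info (Equiv.swap z v c)).isSome) h
        (by simp only [hsz, hsv, hz', hv']; rfl) fun c h1 h2 => hoff c h2 h1,
      fun h => hb.balancedCode (cl' := fun c => (D.info c).isSome)
        (cl := fun c => (D.info (Equiv.swap z v c)).isSome) h
        (by simp only [hsz, hsv, hz', hv']; rfl) fun c h1 h2 => (hoff c h2 h1).symm⟩
  · have hb' : D.IncoherentBigon v z r := ⟨hb.1.symm, hb.2.2, hb.2.1⟩
    exact ⟨fun h => hb.balancedCode (cl := fun c => (D.info c).isSome)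
        (cl' := fun c => (D.info (Equiv.swap z v c)).isSome) h hz' hv' hsz hsv hoff,
      fun h => hb'.balancedCode (cl' := fun c => (D.info c).isSome)
        (cl := fun c => (D.info (Equiv.swap z v c)).isSome) h hsv hsz hv' hz'
        fun c h1 h2 => (hoff c h2 h1).symm⟩

theorem offArc_filter {cl : Passage → Bool} {u A : List Passage}
    (hu : ∀ p ∈ u, ∀ q : Passage, q.1 = p.1 → cl q = false) :
    (offArc u A).filter cl = A.filter cl := by
  rw [offArc, List.filter_filter]
  refine List.filter_congr fun p _ => ?_
  cases h : cl p
  · rfl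
  · simp only [Bool.true_and, decide_eq_true_eq, List.mem_map, not_exists, not_and]
    exact fun q hq hqp => Bool.false_ne_true ((hu q hq p hqp.symm).symm.trans h)

theorem Detour.isBalanced_iff {D D' : Diagram T} (h : Detour D D') :
    D.IsBalanced ↔ D'.IsBalanced := by
  obtain ⟨A, u, A', u', L, L', hD, hD', hu, hu', hA, hL, hinfo⟩ := h
  have hcu : ∀ p ∈ u, ∀ q : Passage, q.1 = p.1 → D.classical q = false := fun p hp q hq => by
    rw [classical, hq, hu p hp]; rfl
  have hcu' : ∀ p ∈ u', ∀ q : Passage, q.1 = p.1 → D'.classical q = false := fun p hp q hq => by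
    rw [classical, hq, hu' p hp]; rfl
  have hcl : ∀ w, (∀ p ∈ w, p ∈ passages D.words) →
      (offArc u w).filter D.classical = (offArc u w).filter D'.classical := by
    refine fun w hw => List.filter_congr fun p hp => ?_
    simp only [offArc, List.mem_filter, decide_eq_true_eq] at hp
    rw [classical, classical, hinfo _ (D.hasCrossing_of_mem (hw p hp.1)) hp.2]
  -- A detour does not affect the subcode of classical passages.
  have hwords : D.words.map (List.filter D.classical) = D'.words.map (List.filter D'.classical) := by
    rw [hD, hD', List.map_cons, List.map_cons, List.filter_append, List.filter_append,
      List.filter_eq_nil_iff (l := u) |>.2 fun p hp => by simp [hcu p hp p rfl],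
      List.filter_eq_nil_iff (l := u') |>.2 fun p hp => by simp [hcu' p hp p rfl], List.append_nil,
      List.append_nil]
    congr 1
    · rw [← offArc_filter hcu, ← offArc_filter hcu', ← hA]
      refine hcl A fun p hp => mem_passages.2 ⟨A ++ u, by simp [hD], by simp [hp]⟩
    · have h1 : L.map (List.filter D.classical) =
          (L.map (offArc u)).map (List.filter D'.classical) := by
        rw [List.map_map]
        refine List.map_congr_left fun w hw => ?_
        rw [Function.comp_apply, ← hcl, offArc_filter hcu]
        exact fun p hp => mem_passages.2 ⟨w, by simp [hD, hw], hp⟩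
      rw [h1, hL, List.map_map]
      exact List.map_congr_left fun w _ => offArc_filter hcu'
  rw [IsBalanced, IsBalanced, ← balancedCode_filter_iff D.nodup (fun _ => rfl) (fun _ _ h => h),
    ← balancedCode_filter_iff D'.nodup (fun _ => rfl) (fun _ _ h => h), hwords]
  have key : ∀ p ∈ passages (D'.words.map (List.filter D'.classical)),
      D.classical p = D'.classical p := by
    intro p hp
    have h1 := hp
    rw [← hwords] at h1
    rw [passages_map_filter, List.mem_filter] at h1 hp
    rw [h1.2, hp.2]
  exact ⟨fun h => h.congr fun p hp => (key p hp).symm, fun h => h.congr key⟩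

end Diagram

theorem swap_mul_swap_mul_swap_apply {α : Type*} [DecidableEq α] {p₁ q₁ p₂ q₂ p₃ q₃ : α}
    (h : [p₁, q₁, p₂, q₂, p₃, q₃].Nodup) (π : Equiv.Perm α)
    (hπ : π = Equiv.swap p₁ q₁ * Equiv.swap p₂ q₂ * Equiv.swap p₃ q₃) :
    π p₁ = q₁ ∧ π q₁ = p₁ ∧ π p₂ = q₂ ∧ π q₂ = p₂ ∧ π p₃ = q₃ ∧ π q₃ = p₃ ∧
      ∀ t ∉ [p₁, q₁, p₂, q₂, p₃, q₃], π t = t := by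
  subst hπ
  simp only [List.nodup_cons, List.mem_cons, not_or, List.not_mem_nil, not_false_eq_true,
    and_true, List.nodup_nil, Equiv.Perm.mul_apply, Equiv.swap_apply_def] at h ⊢
  obtain ⟨⟨n1, n2, n3, n4, n5⟩, ⟨n6, n7, n8, n9⟩, ⟨n10, n11, n12⟩, ⟨n13, n14⟩, n15⟩ := h
  refine ⟨?_, ?_, ?_, ?_, ?_, ?_, ?_⟩
  · simp [*]
  · simp [*]
  · simp [*, Ne.symm n3, Ne.symm n7]
  · simp [*, Ne.symm n2, Ne.symm n6, Ne.symm n10]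
  · simp [*, Ne.symm n5, Ne.symm n12, Ne.symm n9, Ne.symm n14]
  · simp [*, Ne.symm n4, Ne.symm n8, Ne.symm n11, Ne.symm n13, Ne.symm n15]
  · rintro t ⟨h1, h2, h3, h4, h5, h6⟩
    simp [*]

namespace Diagram

/-- Pulled back along the triple swap `π`, the new diagram has the old successor map, and only the
pairing of passages changes, from `opp` to its conjugate by `π`. This is the situation of
`Balanced.triangle`. -/
theorem BraidLikeR3.isBalanced_iff {D D' : Diagram T} (h : BraidLikeR3 D D') :
    D.IsBalanced ↔ D'.IsBalanced := by
  obtain ⟨a, b, c, r, hab, hac, hbc, ⟨h1, h2⟩, ⟨h3, h4⟩, ⟨h5, h6⟩, ⟨i, j, k, hi, hj, hk, -⟩,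
    hw, hinfo⟩ := h
  have hnd : [(a, r), (b, r), (a, !r), (c, r), (b, !r), (c, !r)].Nodup := by
    cases r <;> simp [hab, hac, hbc, Ne.symm hab, Ne.symm hbc]
  have hnd' : [(b, !r), (c, !r), (a, !r), (c, r), (a, r), (b, r)].Nodup := by
    cases r <;> simp [hab, hac, hbc, Ne.symm hab, Ne.symm hac, Ne.symm hbc]
  have hout : ∀ t : Passage, t ∉ [(a, r), (b, r), (a, !r), (c, r), (b, !r), (c, !r)] ↔
      t.1 ≠ a ∧ t.1 ≠ b ∧ t.1 ≠ c := by
    rintro ⟨d, e⟩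
    cases e <;> cases r <;> simp
  have hout' : ∀ t : Passage, t ∉ [(b, !r), (c, !r), (a, !r), (c, r), (a, r), (b, r)] ↔
      t.1 ≠ a ∧ t.1 ≠ b ∧ t.1 ≠ c := by
    rintro ⟨d, e⟩
    cases e <;> cases r <;> simp <;> tauto
  generalize hπ : (Equiv.swap (a, r) (b, r) * Equiv.swap (a, !r) (c, r) *
    Equiv.swap (b, !r) (c, !r) : Equiv.Perm Passage) = π at hw
  obtain ⟨e1, e2, e3, e4, e5, e6, e7⟩ := swap_mul_swap_mul_swap_apply hnd π hπ.symm
  have hS : ∀ t ∈ [(a, r), (b, r), (a, !r), (c, r), (b, !r), (c, !r)], t ∈ passages D.words := by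
    have hA := D.mem_of_hasCrossing (D.hasCrossing_of_mem h1)
    have hB := D.mem_of_hasCrossing (D.hasCrossing_of_mem h5)
    have hC := D.mem_of_hasCrossing (c := c) (D.hasCrossing_of_mem (h4 ▸ succ_mem D.nodup h3))
    simp [hA, hB, hC]
  have hcl : ∀ t : Passage, t ∈ [(a, r), (b, r), (a, !r), (c, r), (b, !r), (c, !r)] →
      D.classical t = true := by
    simp [classical, hi, hj, hk]
  have hmem : ∀ t ∈ [(a, r), (b, r), (a, !r), (c, r), (b, !r), (c, !r)],
      π t ∈ [(a, r), (b, r), (a, !r), (c, r), (b, !r), (c, !r)] := by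
    simp [e1, e2, e3, e4, e5, e6]
  have hπS : ∀ p ∈ passages D.words, π p ∈ passages D.words ∧ D.classical (π p) = D.classical p := by
    intro p hp
    by_cases ht : p ∈ [(a, r), (b, r), (a, !r), (c, r), (b, !r), (c, !r)]
    · exact ⟨hS _ (hmem p ht), by rw [hcl _ ht, hcl _ (hmem p ht)]⟩
    · rw [e7 p ht]
      exact ⟨hp, rfl⟩
  have hpass : passages D'.words = (passages D.words).map π := by
    rw [passages, passages, hw, List.map_flatten]
  have hD' : Balanced {p | p ∈ passages D.words} (succ D.words) (fun p => π.symm (opp (π p)))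
      D.classical ↔ D'.IsBalanced := by
    refine balanced_iff_of_equiv π (fun p hp => ?_) (fun q hq => ?_) (fun p hp => ?_)
      (fun p hp => ?_) fun p hp => ?_
    · simp only [Set.mem_ofPred_eq, hpass] at hp ⊢
      exact List.mem_map_of_mem hp
    · simp only [Set.mem_ofPred_eq, hpass] at hq ⊢
      obtain ⟨p, hp, rfl⟩ := List.mem_map.1 hq
      simpa using hp
    · obtain ⟨w, hwD, hpw⟩ := mem_passages.1 hp
      rw [succ_apply D.nodup hwD hpw, succ_apply D'.nodup (hw ▸ List.mem_map_of_mem hwD)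
        (List.mem_map_of_mem hpw), formPerm_map_apply π (nodup_of_mem D.nodup hwD) hpw]
    · rw [← (hπS p hp).2, classical, classical, hinfo _ (D.hasCrossing_of_mem (hπS p hp).1)]
    · simp
  have hsymm : ∀ {s t}, π s = t → π.symm t = s := fun h => (Equiv.symm_apply_eq π).2 h.symm
  have f1 : opp (a, r) = (a, !r) := rfl
  have f2 : opp (a, !r) = (a, r) := by simp [opp]
  have f3 : opp (b, r) = (b, !r) := rfl
  have f4 : opp (b, !r) = (b, r) := by simp [opp]
  have f5 : opp (c, r) = (c, !r) := rfl
  have f6 : opp (c, !r) = (c, r) := by simp [opp]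
  have hoff : ∀ t : Passage, t.1 ≠ a ∧ t.1 ≠ b ∧ t.1 ≠ c → π.symm (opp (π t)) = opp t := by
    intro t ht
    rw [e7 t ((hout t).2 ht)]
    exact hsymm (e7 _ ((hout _).2 ht))
  rw [← hD']
  constructor <;> intro h
  · refine Balanced.triangle h (succ D.words).injective hS hnd h2 h4 h6 f1 f2 f3 f4 f5 f6
      ?_ ?_ ?_ ?_ ?_ ?_ (fun t ht => ?_) hcl
    · rw [e1, f3, hsymm e6]
    · rw [e6, f4, hsymm e1]
    · rw [e3, f5, hsymm e5]
    · rw [e5, f6, hsymm e3]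
    · rw [e2, f1, hsymm e4]
    · rw [e4, f2, hsymm e2]
    · rw [hout] at ht ⊢
      exact ⟨hoff t ht, ht⟩
  -- The triangle after the move has the original pattern with the first and third strands
  -- exchanged, so the same lemma undoes the move.
  · refine Balanced.triangle h (succ D.words).injective (fun t ht => hS t ?_) hnd' h6 h4 h2
      ?_ ?_ ?_ ?_ ?_ ?_ f4 f3 f2 f1 f6 f5 (fun t ht => ?_) fun t ht => hcl t ?_
    · simp only [List.mem_cons, List.not_mem_nil, or_false] at ht ⊢
      tauto
    · rw [e5, f6, hsymm e3]
    · rw [e3, f5, hsymm e5]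
    · rw [e6, f4, hsymm e1]
    · rw [e1, f3, hsymm e6]
    · rw [e4, f2, hsymm e2]
    · rw [e2, f1, hsymm e4]
    · rw [hout'] at ht ⊢
      rw [hoff t ht]
      exact ⟨rfl, ht⟩
    · simp only [List.mem_cons, List.not_mem_nil, or_false] at ht ⊢
      tauto

theorem Iso.isBalanced_iff {D D' : Diagram T} (h : Iso D D') : D.IsBalanced ↔ D'.IsBalanced := by
  obtain ⟨f, hperm, hinfo⟩ := h
  let E : Passage ≃ Passage := f.prodCongr (Equiv.refl Bool)
  have hE : ∀ p : Passage, E p = (f p.1, p.2) := fun _ => rfl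
  have h1 : ∀ w ∈ D.words, ∃ w' ∈ D'.words, w' ~r w.map E := by
    intro w hw
    have := hperm.subset (List.mem_map_of_mem hw)
    simp only [List.pure_def, List.bind_eq_flatMap, List.mem_map, List.mem_flatMap,
      List.mem_singleton, exists_eq_right] at this
    obtain ⟨w', hw', he⟩ := this
    exact ⟨w', hw', (Quotient.exact he).symm⟩
  have h2 : ∀ w' ∈ D'.words, ∃ w ∈ D.words, w.map E ~r w' := by
    intro w' hw'
    have : (w' : Cycle Passage) ∈
        D.words.map fun w => ((w.map (Prod.map f id) : List Passage) : Cycle Passage) := by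
      refine hperm.symm.subset ?_
      simp only [List.pure_def, List.bind_eq_flatMap, List.mem_map, List.mem_flatMap,
        List.mem_singleton, exists_eq_right]
      exact ⟨w', hw', rfl⟩
    obtain ⟨w, hw, he⟩ := List.mem_map.1 this
    exact ⟨w, hw, Quotient.exact he⟩
  refine balanced_iff_of_equiv E (fun p hp => ?_) (fun q hq => ?_) (fun p hp => ?_)
    (fun p hp => ?_) fun p hp => rfl
  · obtain ⟨w, hw, hpw⟩ := mem_passages.1 hp
    obtain ⟨w', hw', hr⟩ := h1 w hw
    exact mem_passages.2 ⟨w', hw', hr.mem_iff.2 (List.mem_map_of_mem hpw)⟩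
  · obtain ⟨w', hw', hqw⟩ := mem_passages.1 hq
    obtain ⟨w, hw, hr⟩ := h2 w' hw'
    obtain ⟨p, hp, rfl⟩ := List.mem_map.1 (hr.mem_iff.2 hqw)
    rw [Equiv.symm_apply_apply]
    exact mem_passages.2 ⟨w, hw, hp⟩
  · obtain ⟨w, hw, hpw⟩ := mem_passages.1 hp
    obtain ⟨w', hw', hr⟩ := h1 w hw
    rw [succ_apply D.nodup hw hpw, succ_apply D'.nodup hw' (hr.mem_iff.2 (List.mem_map_of_mem hpw)),
      List.formPerm_eq_of_isRotated (nodup_of_mem D'.nodup hw') hr,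
      formPerm_map_apply E (nodup_of_mem D.nodup hw) hpw]
  · rw [classical, classical, hE, hinfo _ (D.hasCrossing_of_mem hp)]

theorem BraidLikeMove.isBalanced_iff {D D' : Diagram T} (h : BraidLikeMove D D') :
    D.IsBalanced ↔ D'.IsBalanced := by
  cases h with
  | iso h => exact h.isBalanced_iff
  | r1 h => exact h.isBalanced_iff
  | r2 h => exact h.isBalanced_iff
  | r3 h => exact h.isBalanced_iff
  | detour h => exact h.isBalanced_iff
  | virtualization _ h => exact h.isBalanced_iff

theorem BraidLikeEquivalent.isBalanced_iff {D D' : Diagram T} (h : BraidLikeEquivalent D D') :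
    D.IsBalanced ↔ D'.IsBalanced := by
  induction h with
  | rel _ _ h => exact h.isBalanced_iff
  | refl => exact Iff.rfl
  | symm _ _ _ ih => exact ih.symm
  | trans _ _ _ _ _ ih₁ ih₂ => exact ih₁.trans ih₂

end Diagram

/-! ### Planarity from an explicit list of faces -/

/-- If a map permutes each of the disjoint cyclic lists `F`, which cover the set `S`, then these are
the classes of the equivalence relation that the map generates. -/
theorem card_quot_eq_length {α : Type*} [DecidableEq α] {S : α → Prop} (f : α → α)
    (F : List (List α)) (hF : F.flatten.Nodup) (hne : [] ∉ F) (hS : ∀ a, S a ↔ a ∈ F.flatten)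
    (hf : ∀ l ∈ F, l.map f = l.rotate 1) :
    Nat.card (Quot fun s t : {a // S a} => f s.1 = t.1) = F.length := by
  let r : {a // S a} → {a // S a} → Prop := fun s t => f s.1 = t.1
  have hfm : ∀ l ∈ F, ∀ a ∈ l, f a ∈ l := by
    intro l hl a ha
    have : f a ∈ l.map f := List.mem_map_of_mem ha
    rw [hf l hl] at this
    exact List.mem_rotate.1 this
  have huniq : ∀ i j (hi : i < F.length) (hj : j < F.length) a, a ∈ F[i] → a ∈ F[j] → i = j := by
    intro i j hi hj a hai haj
    have hp := (List.nodup_flatten.1 hF).2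
    rw [List.pairwise_iff_getElem] at hp
    rcases lt_trichotomy i j with h | h | h
    · exact (hp i j hi hj h hai haj).elim
    · exact h
    · exact (hp j i hj hi h haj hai).elim
  have hidx : ∀ s : {a // S a}, ∃ i : Fin F.length, s.1 ∈ F[i] := by
    rintro ⟨a, ha⟩
    obtain ⟨l, hl, hal⟩ := List.mem_flatten.1 ((hS a).1 ha)
    obtain ⟨i, hi, rfl⟩ := List.getElem_of_mem hl
    exact ⟨⟨i, hi⟩, hal⟩
  choose g hg using hidx
  have hgr : ∀ s t, r s t → g s = g t := by
    intro s t hst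
    have h1 := hfm _ (List.getElem_mem (g s).2) _ (hg s)
    rw [show f s.1 = t.1 from hst] at h1
    exact Fin.ext (huniq _ _ _ _ _ h1 (hg t))
  -- Stepping along a cyclic list identifies each entry with its head, so the index `g` separates
  -- the classes.
  have hconn : ∀ (i : Fin F.length) (k : ℕ) (hk : k < F[i].length) (s t : {a // S a}),
      s.1 = F[i][0] → t.1 = F[i][k] → Quot.mk r s = Quot.mk r t := by
    intro i k
    induction k with
    | zero =>
      intro hk s t hs ht
      rw [Subtype.ext (hs.trans ht.symm)]
    | succ k ih =>
      intro hk s t hs ht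
      have hm : S F[i][k] := (hS _).2 (List.mem_flatten.2 ⟨F[i], List.getElem_mem _,
        List.getElem_mem _⟩)
      rw [ih (by omega) s ⟨_, hm⟩ hs rfl]
      refine Quot.sound ?_
      have h1 : (F[i].map f)[k]'(by simpa using Nat.lt_of_succ_lt hk) =
          (F[i].rotate 1)[k]'(by simpa using Nat.lt_of_succ_lt hk) := by
        simp only [hf F[i] (List.getElem_mem _)]
      rw [List.getElem_map, List.getElem_rotate] at h1
      simp only [Nat.mod_eq_of_lt hk] at h1
      change f F[i][k] = t.1
      rw [h1, ht]
  have hinj : Function.Bijective (Quot.lift g hgr) := by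
    constructor
    · rintro ⟨s⟩ ⟨t⟩ hst
      have hst : g s = g t := hst
      have h1 := hg s
      have h2 := hg t
      rw [← hst] at h2
      obtain ⟨k, hk, hk'⟩ := List.getElem_of_mem h1
      obtain ⟨m, hm, hm'⟩ := List.getElem_of_mem h2
      have h0 : S (F[g s][0]'(by omega)) := (hS _).2 (List.mem_flatten.2 ⟨F[g s],
        List.getElem_mem _, List.getElem_mem _⟩)
      exact (hconn (g s) k hk ⟨_, h0⟩ s rfl hk'.symm).symm.trans
        (hconn (g s) m hm ⟨_, h0⟩ t rfl hm'.symm)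
    · intro i
      obtain ⟨a, ha⟩ := List.exists_mem_of_ne_nil F[i] fun h => hne (h ▸ List.getElem_mem _)
      refine ⟨Quot.mk _ ⟨a, (hS a).2 (List.mem_flatten.2 ⟨_, List.getElem_mem _, ha⟩)⟩, ?_⟩
      exact Fin.ext (huniq _ _ _ _ _ (hg ⟨a, _⟩) ha)
  change Nat.card (Quot r) = _
  rw [Nat.card_eq_of_bijective _ hinj, Nat.card_fin]

/-- A walk by successor and opposite steps that visits every passage connects them all; repetitions
are allowed. -/
theorem card_piece_eq_one {W : List (List Passage)} (p : Passage) (P : List Passage)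
    (hP : (p :: P).IsChain fun p q => succ W p = q ∨ opp p = q)
    (hW : ∀ q, q ∈ passages W ↔ q ∈ p :: P) : Nat.card (Piece W) = 1 := by
  let r : {p // p ∈ passages W} → {p // p ∈ passages W} → Prop :=
    fun p q => succ W p.1 = q.1 ∨ opp p.1 = q.1
  have key : ∀ (P : List Passage) (p : Passage),
      (p :: P).IsChain (fun p q => succ W p = q ∨ opp p = q) →
      (∀ q ∈ p :: P, q ∈ passages W) → ∀ (hp : p ∈ passages W) (q : {p // p ∈ passages W}),
      q.1 ∈ p :: P → Quot.mk r ⟨p, hp⟩ = Quot.mk r q := by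
    intro P
    induction P with
    | nil =>
      intro p _ _ hp q hq
      rw [show q = ⟨p, hp⟩ from Subtype.ext (by simpa using hq)]
    | cons a P ih =>
      intro p hc hm hp q hq
      rw [List.isChain_cons_cons] at hc
      have ha := hm a (by simp)
      rcases List.mem_cons.1 hq with h | h
      · rw [show q = ⟨p, hp⟩ from Subtype.ext h]
      · rw [← ih a hc.2 (fun q hq => hm q (List.mem_cons_of_mem _ hq)) ha q h]
        exact Quot.sound hc.1
  have hp := (hW p).2 List.mem_cons_self
  change Nat.card (Quot r) = 1
  rw [Nat.card_eq_one_iff_exists]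
  refine ⟨Quot.mk r ⟨p, hp⟩, ?_⟩
  rintro ⟨q⟩
  exact (key P p hP (fun q hq => (hW q).2 hq) hp q ((hW q.1).1 q.2)).symm

/-- A connected code is planar if it has the right number of faces. -/
theorem isPlanar_of_faces {W : List (List Passage)} (F : List (List (Passage × Bool)))
    (hF : F.flatten.Nodup) (hne : [] ∉ F)
    (hS : F.flatten.Perm ((passages W).flatMap fun p => [(p, true), (p, false)]))
    (hf : ∀ l ∈ F, l.map (faceStep W) = l.rotate 1)
    (p : Passage) (P : List Passage) (hP : (p :: P).IsChain fun p q => succ W p = q ∨ opp p = q)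
    (hW : passages W ⊆ p :: P) (hW' : p :: P ⊆ passages W)
    (hcard : 2 * F.length = (passages W).length + 4) : IsPlanar W := by
  have h1 : Nat.card (Face W) = F.length := by
    refine card_quot_eq_length (S := fun s => s.1 ∈ passages W) (faceStep W) F hF hne
      (fun s => ?_) hf
    rw [hS.mem_iff]
    obtain ⟨s, e⟩ := s
    cases e <;> simp
  rw [IsPlanar, h1, card_piece_eq_one p P hP fun q => ⟨fun h => hW h, fun h => hW' h⟩]
  exact hcard

/-! ### The examples and their balancedness -/

namespace LinkTheory

/-- Crossing data for which the strand `e` may be regarded as the upper one. -/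
def datum : (T : LinkTheory) → Bool → T.Info
  | .virtual, e => e
  | .flat, _ => ()
  | .free, _ => ()

theorem above_datum (T : LinkTheory) (e : Bool) : T.Above (T.datum e) e := by
  cases T <;> trivial

end LinkTheory

/-- The crossing data of the examples: `1` and `3` are virtual, the other crossings classical. -/
def exampleInfo (T : LinkTheory) (c : ℕ) : Option T.Info :=
  if c = 1 ∨ c = 3 then none else some (T.datum (c ≠ 5))

/-- Two circles that meet in four points, alternately classical and virtual. -/
def twoCircles (T : LinkTheory) : Diagram T where
  words := [[(0, false), (1, true), (2, false), (3, true)],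
    [(0, true), (1, false), (2, true), (3, false)]]
  info := exampleInfo T
  nodup := by decide
  opp_mem := by decide
  planar := isPlanar_of_faces
      [[((0, false), true), ((1, false), true), ((2, false), true), ((3, false), true)],
       [((0, false), false), ((0, true), true)], [((1, true), true), ((1, false), false)],
       [((1, true), false), ((0, true), false), ((3, true), false), ((2, true), false)],
       [((2, false), false), ((2, true), true)], [((3, true), true), ((3, false), false)]]
    (by decide) (by decide) (by decide) (by decide) (0, false)
      [(1, true), (2, false), (3, true), (3, false), (0, true), (1, false), (2, true)]
    (by decide) (by decide) (by decide) (by decide)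

/-- `twoCircles` after an unoriented second Reidemeister move across the central face. -/
def twoCirclesWithBigon (T : LinkTheory) : Diagram T where
  words := [[(0, false), (4, true), (5, false), (1, true), (2, false), (5, true), (4, false),
    (3, true)], [(0, true), (1, false), (2, true), (3, false)]]
  info := exampleInfo T
  nodup := by decide
  opp_mem := by decide
  planar := isPlanar_of_faces
      [[((0, false), true), ((4, false), true), ((3, false), true)],
       [((0, false), false), ((0, true), true), ((5, false), false), ((5, true), true)],
       [((4, true), true), ((2, false), false), ((2, true), true), ((4, false), false)],
       [((4, true), false), ((5, true), false)],
       [((5, false), true), ((1, false), true), ((2, false), true)],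
       [((1, true), true), ((1, false), false)],
       [((1, true), false), ((0, true), false), ((3, true), false), ((2, true), false)],
       [((3, true), true), ((3, false), false)]]
    (by decide) (by decide) (by decide) (by decide) (0, false)
      [(4, true), (5, false), (1, true), (2, false), (5, true), (4, false), (3, true),
       (3, false), (0, true), (1, false), (2, true)]
    (by decide) (by decide) (by decide) (by decide)

/-- A circle with kinks at the vertices of a directed triangle; a second circle meets two of the
kinks, each in a classical and a virtual crossing. -/
def directedTriangle (T : LinkTheory) : Diagram T where
  words := [[(4, true), (5, false), (0, true), (1, false), (5, true), (6, false), (2, true),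
    (3, false), (6, true), (4, false)], [(0, false), (1, true), (2, false), (3, true)]]
  info := exampleInfo T
  nodup := by decide
  opp_mem := by decide
  planar := isPlanar_of_faces
      [[((4, true), true), ((1, false), false), ((1, true), true), ((6, false), false),
        ((6, true), true), ((4, false), false)],
       [((4, true), false), ((6, true), false), ((5, true), false)],
       [((5, false), true), ((0, false), true), ((1, false), true)],
       [((5, false), false), ((5, true), true), ((3, false), false), ((3, true), true)],
       [((0, true), true), ((0, false), false)],
       [((0, true), false), ((3, true), false), ((2, true), false), ((1, true), false)],
       [((6, false), true), ((2, false), true), ((3, false), true)],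
       [((2, true), true), ((2, false), false)], [((4, false), true)]]
    (by decide) (by decide) (by decide) (by decide) (4, true)
      [(5, false), (0, true), (1, false), (5, true), (6, false), (2, true),
       (3, false), (6, true), (4, false), (4, true), (5, false), (0, true), (0, false),
       (1, true), (2, false), (3, true)]
    (by decide) (by decide) (by decide) (by decide)

/-- `directedTriangle` after an unoriented third Reidemeister move. -/
def reversedTriangle (T : LinkTheory) : Diagram T where
  words := [[(5, false), (4, true), (0, true), (1, false), (6, false), (5, true), (2, true),
    (3, false), (4, false), (6, true)], [(0, false), (1, true), (2, false), (3, true)]]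
  info := exampleInfo T
  nodup := by decide
  opp_mem := by decide
  planar := isPlanar_of_faces
      [[((5, false), true), ((4, false), true), ((6, false), true)],
       [((5, false), false), ((5, true), true), ((2, false), true), ((3, false), true)],
       [((4, true), true), ((0, false), true), ((1, false), true), ((4, false), false)],
       [((4, true), false), ((3, false), false), ((3, true), true)],
       [((0, true), true), ((0, false), false)],
       [((0, true), false), ((3, true), false), ((2, true), false), ((1, true), false)],
       [((1, false), false), ((1, true), true), ((5, true), false), ((6, true), false)],
       [((6, false), false), ((6, true), true)], [((2, true), true), ((2, false), false)]]
    (by decide) (by decide) (by decide) (by decide) (5, false)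
      [(4, true), (0, true), (1, false), (6, false), (5, true), (2, true),
       (3, false), (4, false), (6, true), (5, false), (4, true), (0, true), (0, false),
       (1, true), (2, false), (3, true)]
    (by decide) (by decide) (by decide) (by decide)

theorem unorientedR2_twoCircles (T : LinkTheory) :
    (twoCircles T).UnorientedR2 (twoCirclesWithBigon T) :=
  ⟨4, 5, true, ⟨by decide, ⟨by simp [twoCirclesWithBigon, passages], rfl⟩,
    by simp [twoCirclesWithBigon, passages], rfl⟩,
    -- The strand through `(4, true)` and `(5, false)` is the upper one, hence the exceptional datum
    -- at `5`.
    ⟨T.datum true, T.datum false, rfl, rfl, Or.inl ⟨T.above_datum _, T.above_datum _⟩⟩,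
    rfl, fun _ _ => rfl⟩

theorem unorientedR3_directedTriangle (T : LinkTheory) :
    (directedTriangle T).UnorientedR3 (reversedTriangle T) :=
  ⟨4, 5, 6, true, by decide, by decide, by decide,
    ⟨by simp [directedTriangle, passages], rfl⟩, ⟨by simp [directedTriangle, passages], rfl⟩,
    ⟨by simp [directedTriangle, passages], rfl⟩,
    ⟨T.datum true, T.datum false, T.datum true, rfl, rfl, rfl,
      Or.inl ⟨T.above_datum _, T.above_datum _⟩⟩, rfl, fun _ _ => rfl⟩

theorem classical_of_exampleInfo {D : Diagram T} (h : D.info = exampleInfo T) :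
    D.classical = fun p => decide (p.1 ≠ 1 ∧ p.1 ≠ 3) := by
  funext p
  rw [Diagram.classical, h, exampleInfo]
  split_ifs with h <;> simp <;> tauto

theorem isBalanced_twoCircles (T : LinkTheory) : (twoCircles T).IsBalanced := by
  intro κ hκ
  -- For different labels each circle changes colour at `0` and back at `2`; for equal labels a
  -- constant works.
  refine ⟨fun p => κ (0, false) != κ (0, true) && decide (p.1 = 1 ∨ p.1 = 2), ?_⟩
  rw [classical_of_exampleInfo rfl]
  simp [twoCircles, passages, succ, List.formPerm_cons_cons, Equiv.swap_apply_def, outColour,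
    opp] at hκ ⊢
  obtain ⟨h1, h2, -, -, h3, h4, -⟩ := hκ
  simp only [h1, h2, h3, h4]
  cases κ (0, false) <;> cases κ (0, true) <;> simp

theorem not_isBalanced_twoCirclesWithBigon (T : LinkTheory) :
    ¬ (twoCirclesWithBigon T).IsBalanced := by
  intro h
  -- The two circles get different labels, so exactly `4` and `5` are smoothed. This cuts off the
  -- loop at `5` through `1` and `2`, whose only mixed classical crossing is `2`.
  obtain ⟨f, hf⟩ := h (fun p => decide (p ∈ [((0 : ℕ), true), (1, false), (2, true), (3, false)]))
    (by simp [twoCirclesWithBigon, passages, succ, List.formPerm_cons_cons, Equiv.swap_apply_def])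
  rw [classical_of_exampleInfo rfl] at hf
  simp [twoCirclesWithBigon, passages, succ, List.formPerm_cons_cons, Equiv.swap_apply_def,
    outColour, opp] at hf
  obtain ⟨-, -, h1, h2, h3, -⟩ := hf
  rw [h2, h1] at h3
  exact Bool.self_ne_not _ h3

theorem not_isBalanced_directedTriangle (T : LinkTheory) :
    ¬ (directedTriangle T).IsBalanced := by
  intro h
  -- Smoothing at `5` cuts off the kink through `0` and `1`, whose only mixed classical crossing is
  -- `0`.
  obtain ⟨f, hf⟩ := h (fun p => decide (p ∈ [((0 : ℕ), false), (1, true), (2, false), (3, true)]))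
    (by simp [directedTriangle, passages, succ, List.formPerm_cons_cons, Equiv.swap_apply_def])
  rw [classical_of_exampleInfo rfl] at hf
  simp [directedTriangle, passages, succ, List.formPerm_cons_cons, Equiv.swap_apply_def,
    outColour, opp] at hf
  obtain ⟨-, h1, h2, h3, -⟩ := hf
  rw [h2, h1] at h3
  exact Bool.self_ne_not _ h3

theorem isBalanced_reversedTriangle (T : LinkTheory) : (reversedTriangle T).IsBalanced := by
  intro κ hκ
  -- For different labels, smoothing joins the arcs through `0` and `2` into one circle with two
  -- mixed crossings. The list gives the passages entered between `0` and `2` on this circle and on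
  -- the other component.
  refine ⟨fun p => κ (0, false) != κ (0, true) && decide (p ∈ [((1 : ℕ), false), (1, true),
    (2, true), (2, false), (6, false), (5, false)]), ?_⟩
  rw [classical_of_exampleInfo rfl]
  simp [reversedTriangle, passages, succ, List.formPerm_cons_cons, Equiv.swap_apply_def, outColour,
    opp] at hκ ⊢
  obtain ⟨h1, h2, h3, h4, h5, h6, h7, h8, h9, -, h10, h11, -⟩ := hκ
  simp only [h1, h2, h3, h4, h5, h6, h7, h8, h9, h11, h10]
  cases κ (0, false) <;> cases κ (5, false) <;> simp

end VirtualLinks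

theorem mainTheorem5 (T : VirtualLinks.LinkTheory) :
    (∃ D D' : VirtualLinks.Diagram T, D.UnorientedR2 D' ∧ ¬ D.BraidLikeEquivalent D') ∧
      (∃ D D' : VirtualLinks.Diagram T, D.UnorientedR3 D' ∧ ¬ D.BraidLikeEquivalent D') :=
  ⟨⟨_, _, VirtualLinks.unorientedR2_twoCircles T, fun h =>
      VirtualLinks.not_isBalanced_twoCirclesWithBigon T
        (h.isBalanced_iff.1 (VirtualLinks.isBalanced_twoCircles T))⟩,
    ⟨_, _, VirtualLinks.unorientedR3_directedTriangle T, fun h =>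
      VirtualLinks.not_isBalanced_directedTriangle T
        (h.isBalanced_iff.2 (VirtualLinks.isBalanced_reversedTriangle T))⟩⟩
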